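/- A \emph{rooted forest on} $[n]=\{1,\dots,n\}$ is an unordered rooted forest with vertex set $[n]$ (each connected component is a tree with a distinguished root; different vertices carry different labels in $[n]$). A \emph{pattern} of length $k$ is a permutation $\pi=\pi(1)\cdots\pi(k)$ of $[k]$; its \emph{complement} is the pattern $\overline\pi$ with $\overline\pi(i)=k+1-\pi(i)$. A rooted forest \emph{consecutively avoids} $\pi$ if it has no sequence of vertices $v_1,\dots,v_k$ such that $v_i$ is the parent of $v_{i+1}$ for all $1\le i<k$ and the labels of $v_1,\dots,v_k$ are in the same relative order as $\pi(1),\dots,\pi(k)$. Two patterns $\pi,\pi'$ are \emph{c-forest-Wilf equivalent} if for every $n\ge 0$ the number of rooted forests on $[n]$ that consecutively avoid $\pi$ equals the number of those that consecutively avoid $\pi'$. A pattern $\pi$ \emph{satisfies a nontrivial c-forest-Wilf equivalence} if it is c-forest-Wilf equivalent to some pattern $\pi'\notin\{\pi,\overline\pi\}$. \textbf{Theorem.} For every real constant $c$ with $-1<c<1$ there is an integer $n_c$ such that for all $n>n_c$, at least $c^n\,n!$ of the patterns of length $n$ satisfy a nontrivial c-forest-Wilf equivalence. -/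

import Mathlib

/-- An unordered rooted labeled forest on the label set `[n]`. Vertices are identified with their
labels, the elements of `Fin n` (shifted to start at `0`). The forest is recorded by its parent
map: `parent v = none` says that `v` is the root of its component, and `parent v = some u` says
that `u` is the parent of `v`. No vertex is a strict ancestor of itself. -/
@[ext]
structure RootedForest (n : ℕ) where
  /-- The parent of a vertex, or `none` for a root. -/
  parent : Fin n → Option (Fin n)
  /-- Following parents never leads back to the starting vertex. -/
  acyclic : ∀ v : Fin n, ¬ Relation.TransGen (fun u w => parent w = some u) v v

namespace RootedForest

/-- There are finitely many rooted forests on `[n]`, so that `Nat.card` really counts them. -/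
instance instFinite (n : ℕ) : Finite (RootedForest n) :=
  Finite.of_injective RootedForest.parent fun _ _ h => RootedForest.ext h

/-- The vertices `v 0, …, v (k - 1)` form a consecutive instance of the pattern `π` in `F`: each is
the parent of the next one, and their labels are in the same relative order as `π`. -/
def IsConsecutiveInstance {n k : ℕ} (F : RootedForest n) (π : Equiv.Perm (Fin k))
    (v : Fin k → Fin n) : Prop :=
  (∀ i j : Fin k, (j : ℕ) = (i : ℕ) + 1 → F.parent (v j) = some (v i)) ∧
    ∀ i j : Fin k, v i < v j ↔ π i < π j

/-- `F` consecutively avoids `π`: there is no consecutive instance of `π` in `F`. -/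
def ConsecutivelyAvoids {n k : ℕ} (F : RootedForest n) (π : Equiv.Perm (Fin k)) : Prop :=
  ∀ v : Fin k → Fin n, ¬ F.IsConsecutiveInstance π v

end RootedForest

/-- Two patterns are c-forest-Wilf equivalent if, for every `n ≥ 0`, equally many rooted forests
on `[n]` consecutively avoid the one and the other. -/
def CForestWilfEquiv {k l : ℕ} (π : Equiv.Perm (Fin k)) (π' : Equiv.Perm (Fin l)) : Prop :=
  ∀ n : ℕ, Nat.card {F : RootedForest n // F.ConsecutivelyAvoids π} =
    Nat.card {F : RootedForest n // F.ConsecutivelyAvoids π'}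

/-- The complement of a pattern `π` of length `k`; with values in `{1, …, k}` it is
`i ↦ k + 1 - π i`. -/
def patternComplement {k : ℕ} (π : Equiv.Perm (Fin k)) : Equiv.Perm (Fin k) :=
  π.trans Fin.revPerm

/-- The pattern `π` satisfies a nontrivial c-forest-Wilf equivalence: it is c-forest-Wilf
equivalent to a pattern other than itself and its complement. (Patterns of different lengths
are never equivalent, so `π'` is taken of the same length.) -/
def HasNontrivialCForestWilfEquiv {k : ℕ} (π : Equiv.Perm (Fin k)) : Prop :=
  ∃ π' : Equiv.Perm (Fin k),
    CForestWilfEquiv π π' ∧ π' ≠ π ∧ π' ≠ patternComplement π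

/-! Consider patterns of length `T + 4` whose values (from 0) are `1, 4, …, 2, 0, *, 3`, all the
others exceeding `4`. Each is equivalent to the pattern with the values `2` and `3` exchanged, and
only five values are prescribed, so such patterns make up at least a fraction `n⁻⁵` of all, which
eventually exceeds `cⁿ`.

For the equivalence, treat instances `V` of both patterns together. They differ only in the order of
the labels at the free positions `T` and `T + 3`. Overlaps are so restricted
(`IsPathInstance.index_eq`) that instances sharing a free vertex share their first `T + 1` vertices.
The free vertices therefore split into classes, each consisting of one vertex `V T` and the possible
`V (T + 3)` below it. A forest avoids one pattern iff `V T` is always the greatest label of its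
class, and the other iff it is always the least. Exchanging the extreme labels of every class
interchanges the two conditions.

The labels of a class lie between `V 0` and `V 1`, and no other label of its instances does, so the
exchange respects their order. A free vertex may however also start another instance. Hence its
children above `V 0` travel with the label, which keeps such an instance intact, while those below
`V 0`, among them `V (T + 1)`, stay in place. Then instances are neither created nor destroyed
(`IsPathInstance.twist`, `IsPathInstance.untwist`), the classes persist, and the operation is an
involution on forests. -/

section ExtremeSwap

/-! ### Exchanging the extremes of equivalence classes -/

variable {α : Type*} [Fintype α]

open Classical in
/-- The elements related to `u`. -/
noncomputable def relClass (r : α → α → Prop) (u : α) : Finset α :=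
  Finset.univ.filter (r u)

theorem mem_relClass {r : α → α → Prop} {u w : α} : w ∈ relClass r u ↔ r u w := by
  simp [relClass]

variable {r : α → α → Prop}

theorem relClass_nonempty (hr : Equivalence r) (u : α) : (relClass r u).Nonempty :=
  ⟨u, mem_relClass.2 (hr.refl u)⟩

theorem relClass_eq (hr : Equivalence r) {u w : α} (h : r u w) : relClass r u = relClass r w := by
  ext x
  simp only [mem_relClass]
  exact ⟨fun hx => hr.trans (hr.symm h) hx, fun hx => hr.trans h hx⟩

variable [LinearOrder α]

/-- Exchange the least and the greatest element of every class of `r`, fixing all else. -/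
noncomputable def extremeSwap (r : α → α → Prop) (u : α) : α :=
  if h : (relClass r u).Nonempty then
    if u = (relClass r u).min' h then (relClass r u).max' h
    else if u = (relClass r u).max' h then (relClass r u).min' h
    else u
  else u

theorem rel_extremeSwap (hr : Equivalence r) (u : α) : r u (extremeSwap r u) := by
  have hu := relClass_nonempty hr u
  rw [extremeSwap, dif_pos hu]
  split_ifs
  · exact mem_relClass.1 (Finset.max'_mem _ hu)
  · exact mem_relClass.1 (Finset.min'_mem _ hu)
  · exact hr.refl u

theorem extremeSwap_of_forall_ge (hr : Equivalence r) {u w : α} (h : ∀ x, r u x → x ≤ u)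
    (hw : r u w) : extremeSwap r u ≤ w := by
  have hu := relClass_nonempty hr u
  have hmax : u = (relClass r u).max' hu :=
    le_antisymm (Finset.le_max' _ _ (mem_relClass.2 (hr.refl u)))
      (h _ (mem_relClass.1 (Finset.max'_mem _ hu)))
  rw [extremeSwap, dif_pos hu]
  split_ifs with h1
  · rw [← hmax, h1]
    exact Finset.min'_le _ _ (mem_relClass.2 hw)
  · exact Finset.min'_le _ _ (mem_relClass.2 hw)

theorem extremeSwap_of_forall_le (hr : Equivalence r) {u w : α} (h : ∀ x, r u x → u ≤ x)
    (hw : r u w) : w ≤ extremeSwap r u := by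
  have hu := relClass_nonempty hr u
  have hmin : u = (relClass r u).min' hu :=
    le_antisymm (h _ (mem_relClass.1 (Finset.min'_mem _ hu)))
      (Finset.min'_le _ _ (mem_relClass.2 (hr.refl u)))
  rw [extremeSwap, dif_pos hu, if_pos hmin]
  exact Finset.le_max' _ _ (mem_relClass.2 hw)

theorem extremeSwap_involutive (hr : Equivalence r) : Function.Involutive (extremeSwap r) := by
  intro u
  have hu := relClass_nonempty hr u
  have hc := relClass_eq hr (rel_extremeSwap hr u)
  have hmm := Finset.min'_le (relClass r u) _ (Finset.max'_mem _ hu)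
  -- On the whole class of `u` the swap is given by the same two extremes.
  have key : ∀ w, r u w → extremeSwap r w = if w = (relClass r u).min' hu then
      (relClass r u).max' hu else if w = (relClass r u).max' hu then (relClass r u).min' hu
      else w := by
    intro w hw
    have hw' := relClass_nonempty hr w
    rw [extremeSwap, dif_pos hw']
    simp only [relClass_eq hr hw]
  rw [key _ (rel_extremeSwap hr u), key u (hr.refl u)]
  generalize (relClass r u).min' hu = a, (relClass r u).max' hu = b
  split_ifs <;> grind

end ExtremeSwap

/-! ### Hook patterns and their path instances -/

/-- The values `g 0, …, g (T + 3)` begin with `1, 4`, end with `2, 0, *, 3`, and all others exceed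
`4`. -/
structure IsHookPattern (T : ℕ) (g : ℕ → ℕ) : Prop where
  three_le : 3 ≤ T
  zero : g 0 = 1
  one : g 1 = 4
  top : g T = 2
  bottom : g (T + 1) = 0
  last : g (T + 3) = 3
  large : ∀ i < T + 4, i ≠ 0 → i ≠ 1 → i ≠ T → i ≠ T + 1 → i ≠ T + 3 → 4 < g i

/-- The two positions whose values may be exchanged. -/
def IsFree (T i : ℕ) : Prop := i = T ∨ i = T + 3

/-- `V 0, …, V (T + 3)` is a downward path for the parent map `p`, ordered like `g` except that the
order of the two free positions is arbitrary. -/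
structure IsPathInstance {n : ℕ} (T : ℕ) (g : ℕ → ℕ) (p : Fin n → Option (Fin n))
    (V : ℕ → Fin n) : Prop where
  edge : ∀ i < T + 3, p (V (i + 1)) = some (V i)
  lt_iff : ∀ i < T + 4, ∀ j < T + 4, ¬ (IsFree T i ∧ IsFree T j) → (V i < V j ↔ g i < g j)
  ne : V T ≠ V (T + 3)

/-! ### Overlaps of path instances -/

section Involution

variable {n T : ℕ} {g : ℕ → ℕ} {p : Fin n → Option (Fin n)} {V W : ℕ → Fin n}

/-- Parents are unique, so a coincidence of two paths propagates upwards. -/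
theorem IsPathInstance.eq_of_add (hV : IsPathInstance T g p V) (hW : IsPathInstance T g p W)
    {a b : ℕ} (s : ℕ) (ha : a + s < T + 4) (hb : b + s < T + 4) (h : V (a + s) = W (b + s)) :
    V a = W b := by
  induction s with
  | zero => exact h
  | succ s ih =>
    refine ih (by omega) (by omega) ?_
    have h1 := hV.edge (a + s) (by omega)
    have h2 := hW.edge (b + s) (by omega)
    rw [add_assoc, h, ← add_assoc, h2] at h1
    exact (Option.some.inj h1).symm

theorem IsPathInstance.bottom_lt (hg : IsHookPattern T g) (hV : IsPathInstance T g p V) {i : ℕ}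
    (hi : i < T + 4) (h : i ≠ T + 1) : V (T + 1) < V i := by
  have := hg.three_le
  rw [hV.lt_iff _ (by omega) _ hi (by unfold IsFree; omega), hg.bottom]
  have := hg.zero
  have := hg.one
  have := hg.top
  have := hg.last
  have := hg.large i hi
  grind

theorem IsPathInstance.zero_lt (hg : IsHookPattern T g) (hV : IsPathInstance T g p V) {i : ℕ}
    (hi : i < T + 4) (h0 : i ≠ 0) (h : i ≠ T + 1) : V 0 < V i := by
  have := hg.three_le
  rw [hV.lt_iff _ (by omega) _ hi (by unfold IsFree; omega), hg.zero]
  have := hg.one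
  have := hg.top
  have := hg.last
  have := hg.large i hi
  grind

theorem IsPathInstance.free_lt (hg : IsHookPattern T g) (hV : IsPathInstance T g p V) {i j : ℕ}
    (hj : IsFree T j) (hi : i < T + 4) (h0 : i ≠ 0) (h1 : i ≠ T + 1) (h : ¬ IsFree T i) :
    V j < V i := by
  have := hg.three_le
  have hj' : j < T + 4 := by unfold IsFree at hj; omega
  rw [hV.lt_iff _ hj' _ hi (by tauto)]
  have := hg.one
  have := hg.top
  have := hg.last
  have := hg.large i hi
  unfold IsFree at *
  grind

theorem IsPathInstance.one_lt (hg : IsHookPattern T g) (hV : IsPathInstance T g p V) {i : ℕ}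
    (hi : i < T + 4) (h0 : i ≠ 0) (h1 : i ≠ 1) (h : i ≠ T + 1) (hf : ¬ IsFree T i) :
    V 1 < V i := by
  have := hg.three_le
  rw [hV.lt_iff _ (by omega) _ hi (by tauto), hg.one]
  unfold IsFree at hf
  exact hg.large i hi h0 h1 (by omega) (by omega) (by omega)

/-- Two path instances do not overlap in a way that involves a free position of one of them, except
at the same position of both. -/
theorem IsPathInstance.index_eq (hg : IsHookPattern T g) (hV : IsPathInstance T g p V)
    (hW : IsPathInstance T g p W) {i j : ℕ} (hi0 : i ≠ 0) (hi : i < T + 4) (hj : IsFree T j)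
    (h : V i = W j) : i = j := by
  have hT := hg.three_le
  have up : ∀ a b s, a + s = i → b + s = j → V a = W b := by
    rintro a b s rfl rfl
    exact hV.eq_of_add hW s hi (by unfold IsFree at hj; omega) h
  rcases lt_trichotomy i j with hij | hij | hij
  · exfalso
    have h0 := up 0 (j - i) i (by omega) (by omega)
    -- `V 0` lies on `W` strictly between `W 0` and `W T` when `j = T`, so its label is too large to
    -- be below `W T = V i`.
    rcases hj with rfl | rfl
    · have h1 := hV.zero_lt hg hi hi0 (by omega)
      rw [h0, h] at h1
      exact lt_asymm h1 (hW.free_lt hg (Or.inl rfl) (by omega) (by omega) (by omega)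
        (by unfold IsFree; omega))
    · obtain rfl | rfl | h3 : i = 1 ∨ i = 2 ∨ 3 ≤ i := by omega
      · have h1 := hV.zero_lt hg hi hi0 (by omega)
        rw [h0, h] at h1
        exact lt_asymm h1 (hW.free_lt hg (Or.inr rfl) (by omega) (by omega) (by omega)
          (by unfold IsFree; omega))
      · have h1 := hV.one_lt hg hi hi0 (by omega) (by omega) (by unfold IsFree; omega)
        rw [up 1 (T + 2) 1 (by omega) (by omega), h] at h1
        exact lt_asymm h1 (hW.free_lt hg (Or.inr rfl) (by omega) (by omega) (by omega)
          (by unfold IsFree; omega))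
      -- Now `W (T + 1)`, the least label of `W`, lies on `V` strictly below its start `V 0`, and `V
      -- 0` also lies on `W`. So `V 0` would exceed a label other than `V (T + 1)`.
      · have h1 := hW.bottom_lt hg (i := T + 3 - i) (by omega) (by omega)
        rw [← h0, ← up (i - 2) (T + 1) 2 (by omega) (by omega)] at h1
        exact lt_asymm h1 (hV.zero_lt hg (by omega) (by omega) (by omega))
  · exact hij
  · exfalso
    rcases hj with rfl | rfl
    -- Symmetrically, `W 0` would exceed `V (T + 1)`, which lies on `W` at position `2 * T + 1 - i`.
    -- Since `i ≤ T + 3`, the bound `3 ≤ T` makes that position nonzero.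
    · have h1 := hV.bottom_lt hg (i := i - j) (by omega) (by omega)
      rw [up (i - j) 0 j (by omega) (by omega),
        up (j + 1) (2 * j + 1 - i) (i - j - 1) (by omega) (by omega)] at h1
      exact lt_asymm h1 (hW.zero_lt hg (by omega) (by omega) (by omega))
    · omega

theorem IsFree.lt {i : ℕ} (h : IsFree T i) : i < T + 4 := by unfold IsFree at h; omega

theorem IsFree.ge {i : ℕ} (h : IsFree T i) : T ≤ i := by unfold IsFree at h; omega

theorem IsPathInstance.index_eq_and_agree (hg : IsHookPattern T g) (hV : IsPathInstance T g p V)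
    (hW : IsPathInstance T g p W) {i j : ℕ} (hi0 : i ≠ 0) (hi : i < T + 4) (hj : IsFree T j)
    (h : V i = W j) : i = j ∧ ∀ a ≤ T, V a = W a := by
  obtain rfl := hV.index_eq hg hW hi0 hi hj h
  refine ⟨rfl, fun a ha => ?_⟩
  have := hj.ge
  refine hV.eq_of_add hW (i - a) (by omega) (by omega) ?_
  rwa [show a + (i - a) = i by omega]

/-! ### Classes of free vertices and the exchange of their labels -/

/-- `u` and `w` are equal, or occupy free positions of path instances which agree up to position
`T`. -/
def freeRel (T : ℕ) (g : ℕ → ℕ) (p : Fin n → Option (Fin n)) (u w : Fin n) : Prop :=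
  u = w ∨ ∃ V W i j, IsPathInstance T g p V ∧ IsPathInstance T g p W ∧ V T = W T ∧
    IsFree T i ∧ IsFree T j ∧ V i = u ∧ W j = w

theorem freeRel_equivalence (hg : IsHookPattern T g) : Equivalence (freeRel T g p) where
  refl u := Or.inl rfl
  symm := by
    rintro u w (rfl | ⟨V, W, i, j, hV, hW, h, hi, hj, hu, hw⟩)
    · exact Or.inl rfl
    · exact Or.inr ⟨W, V, j, i, hW, hV, h.symm, hj, hi, hw, hu⟩
  trans := by
    rintro u w x (rfl | ⟨V, W, i, j, hV, hW, h, hi, hj, hu, hw⟩) h2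
    · exact h2
    · obtain rfl | ⟨V', W', i', j', hV', hW', h', hi', hj', hu', hw'⟩ := h2
      · exact Or.inr ⟨V, W, i, j, hV, hW, h, hi, hj, hu, hw⟩
      · refine Or.inr ⟨V, W', i, j', hV, hW', ?_, hi, hj', hu, hw'⟩
        have hT := hg.three_le
        have := hj.ge
        have := (hW.index_eq_and_agree hg hV' (by omega) hj.lt hi' (hw.trans hu'.symm)).2 T le_rfl
        rw [h, this, h']

/-- The involution of the vertices which exchanges the extreme labels at free positions. -/
noncomputable def freeSwap (T : ℕ) (g : ℕ → ℕ) (p : Fin n → Option (Fin n)) : Fin n → Fin n :=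
  extremeSwap (freeRel T g p)

/-- Children which keep their position when the labels at free positions are exchanged. -/
def IsBound (T : ℕ) (g : ℕ → ℕ) (p : Fin n → Option (Fin n)) (w : Fin n) : Prop :=
  ∃ V i, IsPathInstance T g p V ∧ IsFree T i ∧ p w = some (V i) ∧ w < V 0

open Classical in
/-- The parent map after exchanging the labels at free positions, together with the children that
are not bound. -/
noncomputable def twistParent (T : ℕ) (g : ℕ → ℕ) (p : Fin n → Option (Fin n)) (u : Fin n) :
    Option (Fin n) :=
  if IsBound T g p (freeSwap T g p u) then (p (freeSwap T g p u)).map (freeSwap T g p)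
  else p (freeSwap T g p u)

open Classical in
/-- Apply `f` at the two free positions of `V`. -/
noncomputable def twistPath (T : ℕ) (f : Fin n → Fin n) (V : ℕ → Fin n) (i : ℕ) : Fin n :=
  if IsFree T i then f (V i) else V i

theorem twistPath_free {f : Fin n → Fin n} {i : ℕ} (h : IsFree T i) :
    twistPath T f V i = f (V i) := if_pos h

theorem twistPath_not_free {f : Fin n → Fin n} {i : ℕ} (h : ¬ IsFree T i) :
    twistPath T f V i = V i := if_neg h

theorem freeSwap_freeSwap (hg : IsHookPattern T g) (u : Fin n) :
    freeSwap T g p (freeSwap T g p u) = u :=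
  extremeSwap_involutive (freeRel_equivalence hg) u

theorem IsPathInstance.exists_freeSwap_eq (hg : IsHookPattern T g) (hV : IsPathInstance T g p V)
    {i : ℕ} (hi : IsFree T i) : ∃ W j, IsPathInstance T g p W ∧ IsFree T j ∧
      (∀ a ≤ T, W a = V a) ∧ freeSwap T g p (V i) = W j := by
  obtain h | ⟨V', W, i', j, hV', hW, h, hi', hj, hu, hw⟩ :=
    rel_extremeSwap (freeRel_equivalence (p := p) hg) (V i)
  · exact ⟨V, i, hV, hi, fun _ _ => rfl, h.symm⟩
  · have hT := hg.three_le
    have := hi.ge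
    have h1 := hV.index_eq_and_agree hg hV' (by omega) hi.lt hi' hu.symm
    have h2 := hV'.index_eq_and_agree hg hW (by omega) (by omega) (Or.inl rfl) h
    exact ⟨W, j, hW, hj, fun a ha => by rw [h1.2 a ha, h2.2 a ha], hw.symm⟩

/-- Every element of a free position is a free position of a twisted path. -/
theorem IsPathInstance.exists_eq_freeSwap (hg : IsHookPattern T g) (hV : IsPathInstance T g p V)
    {i : ℕ} (hi : IsFree T i) : ∃ W j, IsPathInstance T g p W ∧ IsFree T j ∧
      (∀ a ≤ T, W a = V a) ∧ V i = twistPath T (freeSwap T g p) W j := by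
  obtain ⟨W, j, hW, hj, h, e⟩ := hV.exists_freeSwap_eq hg hi
  exact ⟨W, j, hW, hj, h, by rw [twistPath_free hj, ← e, freeSwap_freeSwap hg]⟩

theorem exists_of_freeSwap_ne {u : Fin n} (hg : IsHookPattern T g) (h : freeSwap T g p u ≠ u) :
    ∃ V i, IsPathInstance T g p V ∧ IsFree T i ∧ V i = u := by
  obtain h' | ⟨V, _, i, _, hV, _, _, hi, _, hu, _⟩ :=
    rel_extremeSwap (freeRel_equivalence (p := p) hg) u
  · exact absurd h'.symm h
  · exact ⟨V, i, hV, hi, hu⟩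

theorem IsPathInstance.freeSwap_of_not_free (hg : IsHookPattern T g)
    (hV : IsPathInstance T g p V) {i : ℕ} (h0 : i ≠ 0) (hi : i < T + 4) (hf : ¬ IsFree T i) :
    freeSwap T g p (V i) = V i := by
  by_contra h
  obtain ⟨W, j, hW, hj, e⟩ := exists_of_freeSwap_ne hg h
  exact hf (hV.index_eq hg hW h0 hi hj e.symm ▸ hj)

/-- A parent `V i` with `i ≠ 0` cannot be a free vertex, by `index_eq`. If `V 0` is a free vertex of
`W`, then its child `V 1` exceeds `V 0`, hence `W 0`. -/
theorem IsPathInstance.not_isBound (hg : IsHookPattern T g) (hV : IsPathInstance T g p V) {i : ℕ}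
    (hi : i < T + 3) (h : i ≠ T) : ¬ IsBound T g p (V (i + 1)) := by
  rintro ⟨W, j, hW, hj, e, hlt⟩
  have hT := hg.three_le
  have e' : V i = W j := Option.some.inj ((hV.edge i hi).symm.trans e)
  rcases eq_or_ne i 0 with rfl | h0
  · have h1 := hV.zero_lt hg (i := 0 + 1) (by omega) (by omega) (by omega)
    rw [e'] at h1
    have := hj.ge
    exact lt_asymm (h1.trans hlt)
      (hW.zero_lt hg hj.lt (by omega) (by unfold IsFree at hj; omega))
  · have := hV.index_eq hg hW h0 (by omega) hj e'
    unfold IsFree at hj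
    omega

theorem freeSwap_of_isBound (hg : IsHookPattern T g) {w : Fin n} (h : IsBound T g p w) :
    freeSwap T g p w = w := by
  by_contra hw
  obtain ⟨V, i, hV, hi, rfl⟩ := exists_of_freeSwap_ne hg hw
  have hT := hg.three_le
  have := hi.ge
  obtain ⟨i, rfl⟩ : ∃ m, i = m + 1 := ⟨i - 1, by omega⟩
  have := hi.lt
  exact hV.not_isBound hg (by omega) (by unfold IsFree at hi; omega) h

/-! ### Path instances before and after the exchange -/

/-- Moving the labels at the free positions within the interval between the first two labels does
not affect the order of the path. -/
theorem IsPathInstance.twist_of_edge (hg : IsHookPattern T g) {q : Fin n → Option (Fin n)}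
    {f : Fin n → Fin n} (hV : IsPathInstance T g p V) (hf : Function.Injective f)
    (h0 : ∀ i, IsFree T i → V 0 < f (V i)) (h1 : ∀ i, IsFree T i → f (V i) < V 1)
    (hedge : ∀ i < T + 3, q (twistPath T f V (i + 1)) = some (twistPath T f V i)) :
    IsPathInstance T g q (twistPath T f V) := by
  have hT := hg.three_le
  have lower : ∀ i j, i < T + 4 → IsFree T j → ¬ IsFree T i → (V i < V j ↔ V i < f (V j)) := by
    intro i j hi hj hi'
    have hj' := hj.ge
    obtain rfl | rfl | h : i = 0 ∨ i = T + 1 ∨ (i ≠ 0 ∧ i ≠ T + 1) := by omega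
    · exact iff_of_true (hV.zero_lt hg hj.lt (by omega) (by unfold IsFree at hj; omega)) (h0 j hj)
    · exact iff_of_true (hV.bottom_lt hg hj.lt (by unfold IsFree at hj; omega))
        ((hV.bottom_lt hg (by omega) (by omega)).trans (h0 j hj))
    · have h2 := hV.free_lt hg hj hi h.1 h.2 hi'
      refine iff_of_false h2.not_gt (fun h3 => ?_)
      have h4 := h3.trans (h1 j hj)
      rcases eq_or_ne i 1 with rfl | hi1
      · exact lt_irrefl _ h4
      · exact lt_asymm h4 (hV.one_lt hg hi h.1 hi1 h.2 hi')
  have upper : ∀ i j, i < T + 4 → IsFree T j → ¬ IsFree T i → (V j < V i ↔ f (V j) < V i) := by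
    intro i j hi hj hi'
    have hj' := hj.ge
    obtain rfl | rfl | h : i = 0 ∨ i = T + 1 ∨ (i ≠ 0 ∧ i ≠ T + 1) := by omega
    · exact iff_of_false (hV.zero_lt hg hj.lt (by omega) (by unfold IsFree at hj; omega)).not_gt
        (h0 j hj).not_gt
    · exact iff_of_false (hV.bottom_lt hg hj.lt (by unfold IsFree at hj; omega)).not_gt
        ((hV.bottom_lt hg (by omega) (by omega)).trans (h0 j hj)).not_gt
    · refine iff_of_true (hV.free_lt hg hj hi h.1 h.2 hi') ?_
      rcases eq_or_ne i 1 with rfl | hi1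
      · exact h1 j hj
      · exact (h1 j hj).trans (hV.one_lt hg hi h.1 hi1 h.2 hi')
  refine ⟨hedge, fun i hi j hj hij => ?_, ?_⟩
  · rw [← hV.lt_iff i hi j hj hij]
    by_cases hi' : IsFree T i
    · have hj' : ¬ IsFree T j := fun h => hij ⟨hi', h⟩
      rw [twistPath_free hi', twistPath_not_free hj', upper j i hj hi' hj']
    · by_cases hj' : IsFree T j
      · rw [twistPath_free hj', twistPath_not_free hi', lower i j hi hj' hi']
      · rw [twistPath_not_free hi', twistPath_not_free hj']
  · rw [twistPath_free (Or.inl rfl), twistPath_free (Or.inr rfl)]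
    exact fun h => hV.ne (hf h)

theorem freeSwap_injective (hg : IsHookPattern T g) : Function.Injective (freeSwap T g p) :=
  (extremeSwap_involutive (freeRel_equivalence hg)).injective

theorem IsPathInstance.zero_lt_free (hg : IsHookPattern T g) (hV : IsPathInstance T g p V) {i : ℕ}
    (hi : IsFree T i) : V 0 < V i := by
  have hT := hg.three_le
  have := hi.ge
  exact hV.zero_lt hg hi.lt (by omega) (by unfold IsFree at hi; omega)

theorem IsPathInstance.free_lt_one (hg : IsHookPattern T g) (hV : IsPathInstance T g p V) {i : ℕ}
    (hi : IsFree T i) : V i < V 1 := by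
  have hT := hg.three_le
  exact hV.free_lt hg hi (by omega) (by omega) (by omega) (by unfold IsFree; omega)

theorem IsPathInstance.twist (hg : IsHookPattern T g) (hV : IsPathInstance T g p V) :
    IsPathInstance T g (twistParent T g p) (twistPath T (freeSwap T g p) V) := by
  have hT := hg.three_le
  refine hV.twist_of_edge hg (freeSwap_injective hg) ?_ ?_ ?_
  · intro i hi
    obtain ⟨W, j, hW, hj, h, e⟩ := hV.exists_freeSwap_eq hg hi
    rw [e, ← h 0 (by omega)]
    exact hW.zero_lt_free hg hj
  · intro i hi
    obtain ⟨W, j, hW, hj, h, e⟩ := hV.exists_freeSwap_eq hg hi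
    rw [e, ← h 1 (by omega)]
    exact hW.free_lt_one hg hj
  · intro i hi
    have hs : freeSwap T g p (twistPath T (freeSwap T g p) V (i + 1)) = V (i + 1) := by
      by_cases h : IsFree T (i + 1)
      · rw [twistPath_free h, freeSwap_freeSwap hg]
      · rw [twistPath_not_free h, hV.freeSwap_of_not_free hg (by omega) (by omega) h]
    rw [twistParent, hs]
    rcases eq_or_ne i T with rfl | hiT
    · rw [if_pos ⟨V, i, hV, Or.inl rfl, hV.edge i hi, hV.bottom_lt hg (by omega) (by omega)⟩,
        hV.edge i hi, Option.map_some, twistPath_free (Or.inl rfl)]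
    · rw [if_neg (hV.not_isBound hg hi hiT), hV.edge i hi,
        twistPath_not_free (by unfold IsFree; omega)]

/-- No new instances arise. A moved vertex is free in an old instance, hence in a twisted one, so
the overlap lemma applied in the new forest locates it on `V`. -/
theorem IsPathInstance.untwist (hg : IsHookPattern T g)
    (hV : IsPathInstance T g (twistParent T g p) V) :
    IsPathInstance T g p (twistPath T (freeSwap T g p) V) := by
  have hT := hg.three_le
  have moved : ∀ i, i ≠ 0 → i < T + 4 → freeSwap T g p (V i) ≠ V i → IsFree T i ∧
      ∃ W j, IsPathInstance T g p W ∧ IsFree T j ∧ V i = W j ∧ ∀ a < T, V a = W a := by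
    intro i h0 hi h
    obtain ⟨U, j, hU, hj, e⟩ := exists_of_freeSwap_ne hg h
    obtain ⟨W, l, hW, hl, hWU, e'⟩ := hU.exists_eq_freeSwap hg hj
    obtain ⟨rfl, h2⟩ := hV.index_eq_and_agree hg (hW.twist hg) h0 hi hl (e ▸ e')
    refine ⟨hl, U, j, hU, hj, e.symm, fun a ha => ?_⟩
    rw [h2 a ha.le, twistPath_not_free (by unfold IsFree; omega), hWU a ha.le]
  have bounds : ∀ i, IsFree T i → V 0 < freeSwap T g p (V i) ∧ freeSwap T g p (V i) < V 1 := by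
    intro i hi
    have := hi.ge
    by_cases h : freeSwap T g p (V i) = V i
    · rw [h]
      exact ⟨hV.zero_lt_free hg hi, hV.free_lt_one hg hi⟩
    · obtain ⟨-, W, j, hW, hj, e, hWV⟩ := moved i (by omega) hi.lt h
      obtain ⟨W', j', hW', hj', h', e'⟩ := hW.exists_freeSwap_eq hg hj
      rw [e, e', hWV 0 (by omega), hWV 1 (by omega), ← h' 0 (by omega), ← h' 1 (by omega)]
      exact ⟨hW'.zero_lt_free hg hj', hW'.free_lt_one hg hj'⟩
  refine hV.twist_of_edge hg (freeSwap_injective hg) (fun i hi => (bounds i hi).1)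
    (fun i hi => (bounds i hi).2) ?_
  intro i hi
  have hedge := hV.edge i hi
  rw [twistParent] at hedge
  split_ifs at hedge with hb
  · have hb' := hb
    obtain ⟨U, j, hU, hj, e, hlt⟩ := hb'
    have hfix : freeSwap T g p (V (i + 1)) = V (i + 1) := by
      have := freeSwap_of_isBound hg hb
      rwa [freeSwap_freeSwap hg, eq_comm] at this
    rw [e, Option.map_some, Option.some.injEq] at hedge
    have e2 : V i = twistPath T (freeSwap T g p) U j := by rw [twistPath_free hj, hedge]
    rw [hfix] at hlt e
    rcases eq_or_ne i 0 with rfl | h0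
    · exfalso
      have h1 := hV.zero_lt hg (i := 0 + 1) (by omega) (by omega) (by omega)
      have h2 := (hU.twist hg).zero_lt_free hg hj
      rw [← e2, twistPath_not_free (by unfold IsFree; omega)] at h2
      exact lt_asymm (h1.trans hlt) h2
    · have h1 := hV.index_eq hg (hU.twist hg) h0 (by omega) hj e2
      subst h1
      obtain rfl : i = T := by unfold IsFree at hj; omega
      rw [twistPath_not_free (by unfold IsFree; omega), twistPath_free hj, ← hedge,
        freeSwap_freeSwap hg, e]
  · by_cases hfix : freeSwap T g p (V (i + 1)) = V (i + 1)
    · rw [hfix] at hedge hb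
      have e1 : twistPath T (freeSwap T g p) V (i + 1) = V (i + 1) := by
        unfold twistPath
        split_ifs <;> simp [hfix]
      rw [e1, hedge]
      by_cases hf : IsFree T i
      · obtain rfl : i = T := by unfold IsFree at hf; omega
        rw [twistPath_free hf]
        -- If `V T` were moved, its child `V (T + 1)`, being below `V 0`, would be bound.
        by_contra hne
        obtain ⟨-, W, j, hW, hj, e, hWV⟩ :=
          moved i (by omega) (by omega) (fun h => hne (by rw [h]))
        refine hb ⟨W, j, hW, hj, by rw [hedge, e], ?_⟩
        rw [← hWV 0 (by omega)]
        exact hV.bottom_lt hg (by omega) (by omega)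
      · rw [twistPath_not_free hf]
    · obtain ⟨hf, -⟩ := moved (i + 1) (by omega) (by omega) hfix
      rw [twistPath_free hf, hedge, twistPath_not_free]
      unfold IsFree at hf ⊢
      omega

/-! ### The exchange is an involution -/

theorem freeRel_freeSwap_freeSwap (hg : IsHookPattern T g) {u w : Fin n}
    (h : freeRel T g p u w) : freeRel T g p (freeSwap T g p u) (freeSwap T g p w) := by
  have hr := freeRel_equivalence (p := p) hg
  exact hr.trans (hr.symm (rel_extremeSwap hr u)) (hr.trans h (rel_extremeSwap hr w))

/-- Instances correspond under the exchange, which only permutes labels within each class. -/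
theorem freeRel_twistParent (hg : IsHookPattern T g) :
    freeRel T g (twistParent T g p) = freeRel T g p := by
  ext u w
  constructor
  · rintro (rfl | ⟨V, W, i, j, hV, hW, h, hi, hj, rfl, rfl⟩)
    · exact Or.inl rfl
    · have := freeRel_freeSwap_freeSwap hg (Or.inr ⟨_, _, i, j, hV.untwist hg, hW.untwist hg,
        by rw [twistPath_free (Or.inl rfl), twistPath_free (Or.inl rfl), h], hi, hj, rfl, rfl⟩)
      rwa [twistPath_free hi, twistPath_free hj, freeSwap_freeSwap hg, freeSwap_freeSwap hg]
        at this
  · intro h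
    have h := freeRel_freeSwap_freeSwap hg h
    obtain h | ⟨V, W, i, j, hV, hW, h, hi, hj, hu, hw⟩ := h
    · exact Or.inl (freeSwap_injective hg h)
    · refine Or.inr ⟨_, _, i, j, hV.twist hg, hW.twist hg, ?_, hi, hj, ?_, ?_⟩
      · rw [twistPath_free (Or.inl rfl), twistPath_free (Or.inl rfl), h]
      · rw [twistPath_free hi, hu, freeSwap_freeSwap hg]
      · rw [twistPath_free hj, hw, freeSwap_freeSwap hg]

theorem freeSwap_twistParent (hg : IsHookPattern T g) :
    freeSwap T g (twistParent T g p) = freeSwap T g p := by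
  rw [freeSwap, freeRel_twistParent hg, freeSwap]

theorem twistParent_twistParent (hg : IsHookPattern T g) :
    twistParent T g (twistParent T g p) = p := by
  have hT := hg.three_le
  funext u
  rw [twistParent, freeSwap_twistParent hg]
  by_cases hb : IsBound T g p u
  · have hu := freeSwap_of_isBound hg hb
    obtain ⟨V, i, hV, hi, e, hlt⟩ := id hb
    have ep : twistParent T g p u = some (freeSwap T g p (V i)) := by
      rw [twistParent, hu, if_pos hb, e, Option.map_some]
    rw [hu, if_pos, ep, Option.map_some, freeSwap_freeSwap hg, e]
    refine ⟨_, i, hV.twist hg, hi, by rw [ep, twistPath_free hi], ?_⟩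
    rwa [twistPath_not_free (by unfold IsFree; omega)]
  · have ep : twistParent T g p (freeSwap T g p u) = p u := by
      rw [twistParent, freeSwap_freeSwap hg, if_neg hb]
    rw [if_neg, ep]
    rintro ⟨V, i, hV, hi, e, hlt⟩
    rw [ep] at e
    have hV' := hV.untwist hg
    obtain ⟨W, j, hW, hj, h, e'⟩ := hV'.exists_freeSwap_eq hg hi
    rw [twistPath_free hi, freeSwap_freeSwap hg] at e'
    have hW0 : W 0 = V 0 := by
      rw [h 0 (by omega), twistPath_not_free (by unfold IsFree; omega)]
    by_cases hu : freeSwap T g p u = u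
    · rw [hu] at hlt
      exact hb ⟨W, j, hW, hj, by rw [e, e'], by rwa [hW0]⟩
    -- A moved vertex is at position `T` or `T + 3`; its parent, at `T - 1` or `T + 2`, cannot be
    -- free.
    · obtain ⟨U, l, hU, hl, rfl⟩ := exists_of_freeSwap_ne hg hu
      have := hl.ge
      obtain ⟨l, rfl⟩ : ∃ m, l = m + 1 := ⟨l - 1, by omega⟩
      have := hl.lt
      have e3 : U l = W j := by
        rw [← e']
        exact Option.some.inj ((hU.edge l (by omega)).symm.trans e)
      have := hU.index_eq hg hW (by omega) (by omega) hj e3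
      unfold IsFree at hl hj
      omega

/-! ### The new parent map is acyclic -/

theorem IsPathInstance.transGen (hV : IsPathInstance T g p V) {i j : ℕ} (hij : i < j)
    (hj : j < T + 4) : Relation.TransGen (fun u w => p w = some u) (V i) (V j) := by
  induction j with
  | zero => omega
  | succ j ih =>
    have he := hV.edge j (by omega)
    rcases (Nat.lt_succ_iff.1 hij).eq_or_lt with rfl | h
    · exact .single he
    · exact .tail (ih h (by omega)) he

/-- A vertex has at most one parent, so accessibility passes from a vertex to its descendants. -/
theorem acc_of_transGen_parent {q : Fin n → Option (Fin n)} {a u : Fin n}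
    (h : Relation.TransGen (fun u w => q w = some u) a u)
    (ha : Acc (fun u w => q w = some u) a) : Acc (fun u w => q w = some u) u := by
  induction h with
  | single h =>
    refine ⟨_, fun y hy => ?_⟩
    obtain rfl := Option.some.inj (hy.symm.trans h)
    exact ha
  | tail _ h ih =>
    refine ⟨_, fun y hy => ?_⟩
    obtain rfl := Option.some.inj (hy.symm.trans h)
    exact ih

theorem twistParent_acyclic (hg : IsHookPattern T g)
    (hp : ∀ v, ¬ Relation.TransGen (fun u w => p w = some u) v v) (v : Fin n) :
    ¬ Relation.TransGen (fun u w => twistParent T g p w = some u) v v := by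
  have hT := hg.three_le
  have wf : WellFounded (Relation.TransGen (fun u w => p w = some u)) := by
    have : Std.Irrefl (Relation.TransGen (fun u w => p w = some u)) := ⟨hp⟩
    exact Finite.wellFounded_of_trans_of_irrefl _
  -- Free vertices stay descendants of the unmoved `V (T - 1)`, to which induction along the old
  -- forest applies.
  have up : ∀ {V i}, IsPathInstance T g p V → IsFree T i →
      Relation.TransGen (fun u w => twistParent T g p w = some u) (V (T - 1)) (V i) := by
    intro V i hV hi
    obtain ⟨W, j, hW, hj, h, e⟩ := hV.exists_eq_freeSwap hg hi
    have := hj.ge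
    have := (hW.twist hg).transGen (i := T - 1) (j := j) (by omega) hj.lt
    rwa [twistPath_not_free (by unfold IsFree; omega), h _ (by omega), ← e] at this
  have acc : ∀ u, Acc (fun u w => twistParent T g p w = some u) u := by
    intro u
    induction u using wf.induction with
    | _ u ih =>
      by_cases hu : ∃ V i, IsPathInstance T g p V ∧ IsFree T i ∧ V i = u
      · obtain ⟨V, i, hV, hi, rfl⟩ := hu
        have := hi.ge
        exact acc_of_transGen_parent (up hV hi) (ih _ (hV.transGen (by omega) hi.lt))
      · have hfix : freeSwap T g p u = u := by
          by_contra h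
          exact hu (exists_of_freeSwap_ne hg h)
        by_cases hb : IsBound T g p u
        · obtain ⟨V, i, hV, hi, e, hlt⟩ := id hb
          obtain ⟨W, j, hW, hj, h, e'⟩ := hV.exists_freeSwap_eq hg hi
          have := hi.ge
          have hlow : Relation.TransGen (fun u w => p w = some u) (V (T - 1)) u :=
            .tail (hV.transGen (by omega) hi.lt) e
          rw [← h (T - 1) (by omega)] at hlow
          refine acc_of_transGen_parent (.tail (up hW hj) ?_) (ih _ hlow)
          rw [twistParent, hfix, if_pos hb, e, Option.map_some, e']
        · refine ⟨_, fun y hy => ih y (.single ?_)⟩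
          rwa [twistParent, hfix, if_neg hb] at hy
  exact fun h => (WellFounded.transGen ⟨acc⟩).irrefl.irrefl v h

/-! ### The exchange reverses the order at the free positions -/

theorem twistParent_last_lt (hg : IsHookPattern T g)
    (hp : ∀ V, IsPathInstance T g p V → V T < V (T + 3))
    (hV : IsPathInstance T g (twistParent T g p) V) : V (T + 3) < V T := by
  have hr := freeRel_equivalence (p := p) hg
  have hU := hV.untwist hg
  -- The old label at position `T` is the least of its class, so the new label `V T` is the
  -- greatest.
  have htop : ∀ x, freeRel T g p (freeSwap T g p (V T)) x → freeSwap T g p (V T) ≤ x := by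
    rw [← twistPath_free (V := V) (f := freeSwap T g p) (Or.inl rfl : IsFree T T)]
    rintro x (rfl | ⟨W, W', i, j, hW, hW', h, hi, hj, e, rfl⟩)
    · exact le_rfl
    · have := hg.three_le
      have h1 := (hU.index_eq_and_agree hg hW (by omega) (by omega) hi e.symm).2 T le_rfl
      rw [h1, h]
      rcases hj with rfl | rfl
      · exact le_rfl
      · exact (hp W' hW').le
  refine lt_of_le_of_ne ?_ hV.ne.symm
  have := extremeSwap_of_forall_le hr (w := V (T + 3)) htop
  rw [← freeSwap, freeSwap_freeSwap hg] at this
  apply this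
  refine hr.trans (hr.symm (rel_extremeSwap hr _)) ?_
  rw [← freeRel_twistParent hg]
  exact Or.inr ⟨V, V, T, T + 3, hV, hV, rfl, Or.inl rfl, Or.inr rfl, rfl, rfl⟩

theorem twistParent_top_lt (hg : IsHookPattern T g)
    (hp : ∀ V, IsPathInstance T g p V → V (T + 3) < V T)
    (hV : IsPathInstance T g (twistParent T g p) V) : V T < V (T + 3) := by
  have hr := freeRel_equivalence (p := p) hg
  have hU := hV.untwist hg
  have htop : ∀ x, freeRel T g p (freeSwap T g p (V T)) x → x ≤ freeSwap T g p (V T) := by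
    rw [← twistPath_free (V := V) (f := freeSwap T g p) (Or.inl rfl : IsFree T T)]
    rintro x (rfl | ⟨W, W', i, j, hW, hW', h, hi, hj, e, rfl⟩)
    · exact le_rfl
    · have := hg.three_le
      have h1 := (hU.index_eq_and_agree hg hW (by omega) (by omega) hi e.symm).2 T le_rfl
      rw [h1, h]
      rcases hj with rfl | rfl
      · exact le_rfl
      · exact (hp W' hW').le
  refine lt_of_le_of_ne ?_ hV.ne
  have := extremeSwap_of_forall_ge hr (w := V (T + 3)) htop
  rw [← freeSwap, freeSwap_freeSwap hg] at this
  apply this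
  refine hr.trans (hr.symm (rel_extremeSwap hr _)) ?_
  rw [← freeRel_twistParent hg]
  exact Or.inr ⟨V, V, T, T + 3, hV, hV, rfl, Or.inl rfl, Or.inr rfl, rfl, rfl⟩

end Involution

/-! ### From path instances to patterns -/

section Patterns

variable {n T : ℕ}

/-- The forest obtained by exchanging the labels at free positions. -/
noncomputable def RootedForest.twist {g : ℕ → ℕ} (hg : IsHookPattern T g) (F : RootedForest n) :
    RootedForest n where
  parent := twistParent T g F.parent
  acyclic := twistParent_acyclic hg F.acyclic

theorem RootedForest.twist_involutive {g : ℕ → ℕ} (hg : IsHookPattern T g) :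
    Function.Involutive (RootedForest.twist (n := n) hg) := fun _ =>
  RootedForest.ext (twistParent_twistParent hg)

/-- The values of a pattern as a function on the natural numbers. -/
def patternValue (π : Equiv.Perm (Fin (T + 4))) (i : ℕ) : ℕ := π (Fin.ofNat (T + 4) i)

theorem patternValue_val (π : Equiv.Perm (Fin (T + 4))) (i : Fin (T + 4)) :
    patternValue π i = π i := by
  simp [patternValue]

theorem patternValue_of_lt (π : Equiv.Perm (Fin (T + 4))) {i : ℕ} (hi : i < T + 4) :
    patternValue π i = π ⟨i, hi⟩ :=
  patternValue_val π ⟨i, hi⟩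

/-- Used for both the pattern and its swap, which agree with `g` on all pairs but the free one. -/
theorem consecutivelyAvoids_iff {g : ℕ → ℕ} (F : RootedForest n) (τ : Equiv.Perm (Fin (T + 4)))
    (hτ : ∀ i j : Fin (T + 4), ¬ (IsFree T i ∧ IsFree T j) → (τ i < τ j ↔ g i < g j)) :
    F.ConsecutivelyAvoids τ ↔ ∀ V, IsPathInstance T g F.parent V →
      ¬ (V T < V (T + 3) ↔ τ ⟨T, by omega⟩ < τ ⟨T + 3, by omega⟩) := by
  constructor
  · intro h V hV hlt
    refine h (fun i => V i) ⟨fun i j hij => ?_, fun i j => ?_⟩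
    · have := hV.edge i (by omega)
      rwa [← hij] at this
    · by_cases hij : IsFree T i ∧ IsFree T j
      · have hne : τ ⟨T, by omega⟩ ≠ τ ⟨T + 3, by omega⟩ := by simp
        have hgt : V (T + 3) < V T ↔ τ ⟨T + 3, by omega⟩ < τ ⟨T, by omega⟩ := by
          rw [← not_iff_not, not_lt, not_lt, hV.ne.le_iff_lt, hne.le_iff_lt, hlt]
        obtain ⟨i, hi⟩ := i
        obtain ⟨j, hj⟩ := j
        dsimp only at hij ⊢
        obtain ⟨h1 | h1, h2 | h2⟩ := hij <;> subst i j
        · simp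
        · exact hlt
        · exact hgt
        · simp
      · rw [hV.lt_iff i i.2 j j.2 hij, hτ i j hij]
  · intro h v hv
    have hval : ∀ i (hi : i < T + 4), v (Fin.ofNat (T + 4) i) = v ⟨i, hi⟩ := fun i hi => by
      congr 1
      ext
      simpa using Nat.mod_eq_of_lt hi
    refine h (fun i => v (Fin.ofNat (T + 4) i)) ⟨fun i hi => ?_, fun i hi j hj hij => ?_, ?_⟩ ?_
    · rw [hval i (by omega), hval (i + 1) (by omega)]
      exact hv.1 _ _ rfl
    · rw [hval i hi, hval j hj, hv.2, hτ _ _ hij]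
    · rw [hval T (by omega), hval (T + 3) (by omega)]
      intro he
      rcases lt_trichotomy (τ ⟨T, by omega⟩) (τ ⟨T + 3, by omega⟩) with h1 | h1 | h1
      · exact ((hv.2 _ _).2 h1).ne he
      · simp at h1
      · exact ((hv.2 _ _).2 h1).ne' he
    · simp only [hval T (by omega), hval (T + 3) (by omega)]
      exact hv.2 _ _

/-- The pattern with the values `2` and `3` exchanged. -/
def swapTwoThree (π : Equiv.Perm (Fin (T + 4))) : Equiv.Perm (Fin (T + 4)) :=
  π.trans (Equiv.swap ⟨2, by omega⟩ ⟨3, by omega⟩)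

theorem cForestWilfEquiv_swapTwoThree (π : Equiv.Perm (Fin (T + 4)))
    (hg : IsHookPattern T (patternValue π)) : CForestWilfEquiv π (swapTwoThree π) := by
  intro n
  have hT : π ⟨T, by omega⟩ = ⟨2, by omega⟩ := by
    ext
    rw [← patternValue_of_lt, hg.top]
  have hZ : π ⟨T + 3, by omega⟩ = ⟨3, by omega⟩ := by
    ext
    rw [← patternValue_of_lt, hg.last]
  have hT' : swapTwoThree π ⟨T, by omega⟩ = ⟨3, by omega⟩ := by simp [swapTwoThree, hT]
  have hZ' : swapTwoThree π ⟨T + 3, by omega⟩ = ⟨2, by omega⟩ := by simp [swapTwoThree, hZ]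
  have hother : ∀ i : Fin (T + 4), ¬ IsFree T i →
      swapTwoThree π i = π i ∧ π i ≠ ⟨2, by omega⟩ ∧ π i ≠ ⟨3, by omega⟩ := by
    intro i hi
    have h2 : π i ≠ ⟨2, by omega⟩ := fun h =>
      hi (Or.inl (congrArg Fin.val (π.injective (h.trans hT.symm))))
    have h3 : π i ≠ ⟨3, by omega⟩ := fun h =>
      hi (Or.inr (congrArg Fin.val (π.injective (h.trans hZ.symm))))
    exact ⟨Equiv.swap_apply_of_ne_of_ne h2 h3, h2, h3⟩
  have hfree : ∀ i : Fin (T + 4), IsFree T i →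
      (π i : ℕ) = 2 ∧ (swapTwoThree π i : ℕ) = 3 ∨ (π i : ℕ) = 3 ∧ (swapTwoThree π i : ℕ) = 2 := by
    rintro ⟨i, hi⟩ (h | h) <;> dsimp only at h <;> subst i
    · simp [hT, hT']
    · simp [hZ, hZ']
  have h1 := fun F : RootedForest n => consecutivelyAvoids_iff (g := patternValue π) F π
    (fun i j _ => by rw [patternValue_val, patternValue_val, Fin.lt_def])
  have h2 := fun F : RootedForest n => consecutivelyAvoids_iff (g := patternValue π) F
    (swapTwoThree π) (fun i j hij => by
      rw [patternValue_val, patternValue_val, Fin.lt_def]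
      by_cases hi : IsFree T i
      · have hj := hother j (fun h => hij ⟨hi, h⟩)
        have := hfree i hi
        simp only [ne_eq, Fin.ext_iff] at hj
        omega
      · have hi' := hother i hi
        by_cases hj : IsFree T j
        · have := hfree j hj
          simp only [ne_eq, Fin.ext_iff] at hi'
          omega
        · rw [hi'.1, (hother j hj).1])
  have e1 : ∀ F : RootedForest n, F.ConsecutivelyAvoids π ↔
      ∀ V, IsPathInstance T (patternValue π) F.parent V → V (T + 3) < V T := by
    intro F
    rw [h1]
    refine forall₂_congr fun V hV => ?_
    have hlt : π ⟨T, by omega⟩ < π ⟨T + 3, by omega⟩ := by simp [hT, hZ]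
    rw [iff_true_right hlt, not_lt, hV.ne.symm.le_iff_lt]
  have e2 : ∀ F : RootedForest n, F.ConsecutivelyAvoids (swapTwoThree π) ↔
      ∀ V, IsPathInstance T (patternValue π) F.parent V → V T < V (T + 3) := by
    intro F
    rw [h2]
    refine forall₂_congr fun V hV => ?_
    have hlt : ¬ swapTwoThree π ⟨T, by omega⟩ < swapTwoThree π ⟨T + 3, by omega⟩ := by
      simp [hT', hZ']
    rw [iff_false_right hlt, not_not]
  refine Nat.card_congr (Equiv.subtypeEquiv (RootedForest.twist_involutive hg).toPerm fun F => ?_)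
  rw [e1, e2]
  constructor
  · exact fun h V hV => twistParent_top_lt hg h hV
  · intro h V hV
    rw [← RootedForest.twist_involutive hg F] at hV
    exact twistParent_last_lt hg h hV

theorem hasNontrivialCForestWilfEquiv_of_isHookPattern (π : Equiv.Perm (Fin (T + 4)))
    (hg : IsHookPattern T (patternValue π)) : HasNontrivialCForestWilfEquiv π := by
  have hT := hg.three_le
  have h0 : (π ⟨0, by omega⟩ : ℕ) = 1 := by rw [← patternValue_of_lt, hg.zero]
  have h2 : (π ⟨T, by omega⟩ : ℕ) = 2 := by rw [← patternValue_of_lt, hg.top]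
  refine ⟨_, cForestWilfEquiv_swapTwoThree π hg, fun h => ?_, fun h => ?_⟩
  · have h2' : π ⟨T, by omega⟩ = ⟨2, by omega⟩ := Fin.ext h2
    have := congrArg Fin.val (DFunLike.congr_fun h ⟨T, by omega⟩)
    simp [swapTwoThree, h2'] at this
  · have h0' : π ⟨0, by omega⟩ = ⟨1, by omega⟩ := Fin.ext h0
    -- At position `0` the swapped pattern has value `1`, the complement `T + 2`.
    have := congrArg Fin.val (DFunLike.congr_fun h ⟨0, by omega⟩)
    simp only [swapTwoThree, patternComplement, Equiv.trans_apply, h0', Fin.revPerm_apply,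
      Fin.val_rev] at this
    rw [Equiv.swap_apply_of_ne_of_ne (by simp) (by simp)] at this
    simp only at this
    omega

/-! ### Counting hook patterns -/

/-- The positions of the prescribed values of a hook pattern. -/
def hookPosition (T : ℕ) (j : Fin 5) : Fin (T + 4) :=
  ![⟨T + 1, by omega⟩, ⟨0, by omega⟩, ⟨T, by omega⟩, ⟨T + 3, by omega⟩, ⟨1, by omega⟩] j

theorem hookPosition_injective (hT : 3 ≤ T) : Function.Injective (hookPosition T) := by
  intro a b h
  fin_cases a <;> fin_cases b <;> simp [hookPosition] at h ⊢ <;> omega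

theorem isHookPattern_of_hookPosition (hT : 3 ≤ T) (π : Equiv.Perm (Fin (T + 4)))
    (h : ∀ j, (π (hookPosition T j) : ℕ) = j) : IsHookPattern T (patternValue π) where
  three_le := hT
  zero := by rw [patternValue_of_lt _ (by omega)]; exact h 1
  one := by rw [patternValue_of_lt _ (by omega)]; exact h 4
  top := by rw [patternValue_of_lt _ (by omega)]; exact h 2
  bottom := by rw [patternValue_of_lt _ (by omega)]; exact h 0
  last := by rw [patternValue_of_lt _ (by omega)]; exact h 3
  large := by
    intro i hi h0 h1 h2 h3 h4
    rw [patternValue_of_lt _ hi]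
    by_contra hlt
    have hj := h ⟨π ⟨i, hi⟩, by omega⟩
    have := congrArg Fin.val (π.injective (Fin.ext hj))
    generalize (⟨π ⟨i, hi⟩, by omega⟩ : Fin 5) = j at this
    fin_cases j <;> simp [hookPosition] at this <;> omega

/-- The permutations with prescribed values at `r` positions make up at least a fraction `n⁻ʳ`. -/
theorem factorial_le_card_mul_pow {n r : ℕ} {a b : Fin r → Fin n} (ha : Function.Injective a)
    (hb : Function.Injective b) : n.factorial ≤
      Nat.card {π : Equiv.Perm (Fin n) // ∀ j, π (a j) = b j} * n ^ r := by
  have hex : ∀ x : Fin r → Fin n, ∃ σ : Equiv.Perm (Fin n),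
      Function.Injective x → ∀ j, σ (x j) = b j := by
    intro x
    by_cases hx : Function.Injective x
    · obtain ⟨σ, hσ⟩ := Equiv.Perm.exists_extending_pair x b hx hb
      exact ⟨σ, fun _ => hσ⟩
    · exact ⟨1, fun h => absurd h hx⟩
  choose σ hσ using hex
  -- The correction `σ` depends only on `π ∘ a`, the second component, so `π` can be recovered.
  let f : Equiv.Perm (Fin n) →
      {π : Equiv.Perm (Fin n) // ∀ j, π (a j) = b j} × (Fin r → Fin n) := fun π =>
    (⟨σ (π ∘ a) * π, hσ (π ∘ a) (π.injective.comp ha)⟩, π ∘ a)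
  have hf : Function.Injective f := by
    intro π π' h
    have h2 : π ∘ a = π' ∘ a := congrArg Prod.snd h
    have h1 : σ (π ∘ a) * π = σ (π' ∘ a) * π' := congrArg (fun x => x.1.1) h
    rw [h2] at h1
    exact mul_left_cancel h1
  have := Nat.card_le_card_of_injective f hf
  rwa [Nat.card_prod, Nat.card_eq_fintype_card, Fintype.card_perm, Fintype.card_fin,
    Nat.card_fun, Nat.card_eq_fintype_card (α := Fin n), Nat.card_eq_fintype_card (α := Fin r),
    Fintype.card_fin, Fintype.card_fin] at this

theorem factorial_le_card_hasNontrivialCForestWilfEquiv_mul_pow {n : ℕ} (hn : 7 ≤ n) :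
    n.factorial ≤
      Nat.card {π : Equiv.Perm (Fin n) // HasNontrivialCForestWilfEquiv π} * n ^ 5 := by
  obtain ⟨T, rfl⟩ : ∃ T, n = T + 4 := ⟨n - 4, by omega⟩
  have hT : 3 ≤ T := by omega
  refine (factorial_le_card_mul_pow (hookPosition_injective hT)
    (Fin.castLE_injective (show 5 ≤ T + 4 by omega))).trans (Nat.mul_le_mul_right _ ?_)
  refine Nat.card_le_card_of_injective
    (Subtype.map id fun π hπ => hasNontrivialCForestWilfEquiv_of_isHookPattern π
      (isHookPattern_of_hookPosition hT π fun j => ?_))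
    (Subtype.map_injective _ Function.injective_id)
  rw [hπ j, Fin.val_castLE]

end Patterns

theorem theorem1p7 (c : ℝ) (hc_gt : -1 < c) (hc_lt : c < 1) :
    ∃ N : ℕ, ∀ n : ℕ, N < n →
      c ^ n * (Nat.factorial n : ℝ) ≤
        (Nat.card {π : Equiv.Perm (Fin n) // HasNontrivialCForestWilfEquiv π} : ℝ) := by
  have hlim := tendsto_pow_const_mul_const_pow_of_abs_lt_one 5 (abs_lt.2 ⟨hc_gt, hc_lt⟩)
  obtain ⟨N, hN⟩ := Filter.eventually_atTop.1 (hlim.eventually_le_const one_pos)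
  -- Beyond `N`, `n ^ 5 * c ^ n ≤ 1`; the `7` secures `3 ≤ T`.
  refine ⟨N + 7, fun n hn => ?_⟩
  rcases lt_or_ge (c ^ n) 0 with hneg | hpos
  · exact (mul_nonpos_of_nonpos_of_nonneg hneg.le (Nat.cast_nonneg _)).trans (Nat.cast_nonneg _)
  · have hcard : (n.factorial : ℝ) ≤
        Nat.card {π : Equiv.Perm (Fin n) // HasNontrivialCForestWilfEquiv π} * (n : ℝ) ^ 5 := by
      exact_mod_cast factorial_le_card_hasNontrivialCForestWilfEquiv_mul_pow (n := n) (by omega)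
    calc c ^ n * (n.factorial : ℝ)
        ≤ c ^ n * (Nat.card {π : Equiv.Perm (Fin n) // HasNontrivialCForestWilfEquiv π} *
            (n : ℝ) ^ 5) := mul_le_mul_of_nonneg_left hcard hpos
      _ = Nat.card {π : Equiv.Perm (Fin n) // HasNontrivialCForestWilfEquiv π} *
            ((n : ℝ) ^ 5 * c ^ n) := by ring
      _ ≤ _ := mul_le_of_le_one_right (Nat.cast_nonneg _) (hN n (by omega))
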